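/- Let $n\ge 2$ and $\gamma>1$. Consider the full compressible Euler system in $n$ space dimensions in conserved variables $U=(\rho,m,E)\in\mathbb R\times\mathbb R^n\times\mathbb R$, $$\partial_t\rho+\operatorname{div} m=0,\qquad \partial_t m+\operatorname{div}\Big(\frac{m\otimes m}{\rho}\Big)+\nabla p=0,\qquad \partial_t E+\operatorname{div}\Big((E+p)\frac{m}{\rho}\Big)=0,$$ with $p=p(\rho,m,E)=(\gamma-1)\big(E-\tfrac{|m|^2}{2\rho}\big)$, on the phase space $\mathcal O=\{(\rho,m,E):\ \rho>0,\ p(\rho,m,E)>0\}$. For $k=1,\dots,n$ let $$F_k(U)=\Big(m_k,\ \frac{m_k}{\rho}\,m+p\,e_k,\ (E+p)\frac{m_k}{\rho}\Big)$$ be the $k$-th column of its flux. A function $\eta\in C^\infty(\mathcal O)$ is called a companion if there is $q\in C^\infty(\mathcal O;\mathbb R^n)$, called a corresponding flux, with $\nabla_U q_k=\nabla_U\eta\cdot\nabla_U F_k$ on $\mathcal O$ for all $k=1,\dots,n$. A convex companion is called an entropy. Then: (i) A function $\eta:\mathcal O\to\mathbb R$ is a companion if and only if there exist $Z\in C^\infty(\mathbb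 R)$, $a,c\in\mathbb R$ and $b\in\mathbb R^n$ such that on $\mathcal O$ $$\eta(\rho,m,E)=-\rho\,Z\Big(\log\frac{p(\rho,m,E)}{\rho^\gamma}\Big)+aE+m\cdot b+c. \qquad (*)$$ (ii) If $\eta$ is given by $(*)$ with $Z\in C^\infty(\mathbb R)$, then the corresponding fluxes are, up to an additive constant in $\mathbb R^n$, exactly $$q(\rho,m,E)=-m\,Z\Big(\log\frac{p}{\rho^\gamma}\Big)+a(E+p)\frac{m}{\rho}+(m\cdot b)\frac{m}{\rho}+p\,b,\qquad p=p(\rho,m,E).$$ (iii) If $\eta$ is given by $(*)$ with $Z\in C^\infty(\mathbb R)$ such that $Z'(s)\ge 0$ and $Z''(s)\le 0$ for all $s\in\mathbb R$, then $\eta$ is convex, i.e. an entropy. (iv) Conversely, if $\eta$ given by $(*)$ with $Z\in C^\infty(\mathbb R)$ is an entropy, then $Z'(s)\ge 0$ for all $s\in\mathbb R$. -/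

import Mathlib

open scoped ContDiff

noncomputable section

/-- `(η, q)` is a companion pair of the system `∂ₜ U + ∑ₖ ∂ₖ (F k U) = 0` on the open phase space
`O ⊆ V`: `η` and `q` are smooth on `O`, and `∇ q_k = ∇ η · ∇ F_k` at every state of `O`.
Here `F k : V → V` is the `k`-th column of the flux matrix. -/
def IsCompanionPair {V : Type*} [NormedAddCommGroup V] [NormedSpace ℝ V] {n : ℕ}
    (O : Set V) (F : Fin n → V → V) (η : V → ℝ) (q : V → EuclideanSpace ℝ (Fin n)) : Prop :=
  ContDiffOn ℝ ∞ η O ∧ ContDiffOn ℝ ∞ q O ∧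
    ∀ k : Fin n, ∀ U ∈ O,
      fderiv ℝ (fun W => q W k) U = (fderiv ℝ η U).comp (fderiv ℝ (F k) U)

/-- `η` is a companion: it admits a flux. -/
def IsCompanion {V : Type*} [NormedAddCommGroup V] [NormedSpace ℝ V] {n : ℕ}
    (O : Set V) (F : Fin n → V → V) (η : V → ℝ) : Prop :=
  ∃ q : V → EuclideanSpace ℝ (Fin n), IsCompanionPair O F η q

/-- An entropy is a convex companion. -/
def IsEntropy {V : Type*} [NormedAddCommGroup V] [NormedSpace ℝ V] {n : ℕ}
    (O : Set V) (F : Fin n → V → V) (η : V → ℝ) : Prop :=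
  IsCompanion O F η ∧ ConvexOn ℝ O η

namespace FullEuler

/-- Conserved variables `U = (ρ, m, E)`: density, momentum, energy. -/
abbrev State (n : ℕ) : Type := ℝ × EuclideanSpace ℝ (Fin n) × ℝ

/-- The pressure `p(ρ, m, E) = (γ - 1) (E - |m|² / (2ρ))`. -/
def pressure {n : ℕ} (γ : ℝ) (U : State n) : ℝ :=
  (γ - 1) * (U.2.2 - 1 / 2 * (‖U.2.1‖ ^ 2 / U.1))

/-- States with positive density and positive pressure (hence with positive energy). -/
def phaseSpace (n : ℕ) (γ : ℝ) : Set (State n) :=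
  {U | 0 < U.1 ∧ 0 < pressure γ U}

/-- The `k`-th column of the flux matrix of the full compressible Euler system:
`(m_k, (m_k / ρ) m + p e_k, (E + p) m_k / ρ)`. -/
def flux {n : ℕ} (γ : ℝ) (k : Fin n) (U : State n) : State n :=
  (U.2.1 k,
    (U.2.1 k / U.1) • U.2.1 + pressure γ U • EuclideanSpace.single k (1 : ℝ),
    (U.2.2 + pressure γ U) * (U.2.1 k / U.1))

/-- `η(ρ, m, E) = -ρ Z(log(p / ρ^γ)) + a E + m · b + c`. -/
def companion {n : ℕ} (γ : ℝ) (Z : ℝ → ℝ) (a : ℝ) (b : EuclideanSpace ℝ (Fin n)) (c : ℝ)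
    (U : State n) : ℝ :=
  -U.1 * Z (Real.log (pressure γ U / U.1 ^ γ)) + a * U.2.2 + inner ℝ U.2.1 b + c

/-- `q(ρ, m, E) = -Z(log(p / ρ^γ)) m + a (E + p) m / ρ + (m · b) m / ρ + p b`. -/
def companionFlux {n : ℕ} (γ : ℝ) (Z : ℝ → ℝ) (a : ℝ) (b : EuclideanSpace ℝ (Fin n))
    (U : State n) : EuclideanSpace ℝ (Fin n) :=
  -(Z (Real.log (pressure γ U / U.1 ^ γ)) • U.2.1)
    + (a * (U.2.2 + pressure γ U)) • (U.1⁻¹ • U.2.1)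
    + (inner ℝ U.2.1 b) • (U.1⁻¹ • U.2.1)
    + pressure γ U • b

end FullEuler

end

/-!
The proof works in primitive variables `(ρ, u, p)`, in which `F_k` differs from `u_k U` only by
pressure terms. If `(η, q)` is a companion pair, the relative flux `Q_k = q_k - u_k η` satisfies

`∂_ρ Q_k = 0`, `∂_{u_j} Q_k = δ_{jk} G`, `∂_p Q_k = η_{u_k} / ρ`, where `G = ρ η_ρ + γ p η_p - η`

(`hasDerivAt_relativeFlux`, `dilation`). So `Q_k` is a function of `(u_k, p)`, and so is its
derivative `G`, for every `k`; in at least two dimensions `G` therefore depends on `p` only and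
`Q_k = G(p) u_k + H_k(p)`. The third equation then gives
`η(ρ, u, p) = η(ρ, 0, p) + ρ (G'(p) |u|² / 2 + H'(p) · u)` (`exists_kinetic_coefficients`). The
difference `η(ρ, u, p) - η(ρ, 0, p)` is homogeneous of degree one in `ρ`, and since `G` is the same
at `u` and at `0`, it does not depend on `p`: `G' = a` and `H' = b` are constant
(`exists_constant_kinetic_coefficients`). What remains is `ρ K_ρ + γ p K_p - K = a p + β` for
`K(ρ, p) = η(ρ, 0, p)`, so that `(K - a p / (γ - 1) + β) / ρ` is constant along the isentropes
`p = exp s * ρ ^ γ`; this constant is `-Z(s)` (`exists_eq_companion`). In this argument `η` is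
differentiated only once.

Conversely, the flux `u_k (η + a p - c) + p b_k` satisfies the three equations
(`isCompanionPair_companion`), and a flux is unique up to a constant because the phase space is open
and convex. For convexity, `ρ log (p / ρ ^ γ)` is concave, and `ρ Z(·)` inherits this through the
mass fractions of a mixture when `Z` is nondecreasing and concave (`convexOn_companion`). Finally,
midpoint convexity between two states with opposite velocities shows directly that `Z` is monotone
(`monotone_of_convexOn_companion`).
-/

/-! ### Uniqueness of the flux -/

lemma IsCompanionPair.congr_add_const {V : Type*} [NormedAddCommGroup V] [NormedSpace ℝ V] {n : ℕ}
    {O : Set V} (hO : IsOpen O) {F : Fin n → V → V} {η η' : V → ℝ}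
    {q q' : V → EuclideanSpace ℝ (Fin n)} (h : IsCompanionPair O F η q) (d : EuclideanSpace ℝ (Fin n))
    (hη : ∀ U ∈ O, η' U = η U) (hq : ∀ U ∈ O, q' U = q U + d) : IsCompanionPair O F η' q' := by
  refine ⟨h.1.congr hη, (h.2.1.add contDiffOn_const).congr hq, fun k U hU => ?_⟩
  have hnhds := hO.mem_nhds hU
  have e1 : η' =ᶠ[nhds U] η := Filter.eventuallyEq_of_mem hnhds hη
  have e2 : (fun W => q' W k) =ᶠ[nhds U] fun W => q W k + d k :=
    Filter.eventuallyEq_of_mem hnhds fun W hW => by simp [hq W hW]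
  rw [e1.fderiv_eq, e2.fderiv_eq, fderiv_add_const, h.2.2 k U hU]

lemma IsCompanionPair.exists_eq_add_const {V : Type*} [NormedAddCommGroup V] [NormedSpace ℝ V]
    {n : ℕ} {O : Set V} (hO : IsOpen O) (hO' : IsPreconnected O) {F : Fin n → V → V} {η : V → ℝ}
    {q q' : V → EuclideanSpace ℝ (Fin n)} (h : IsCompanionPair O F η q)
    (h' : IsCompanionPair O F η q') : ∃ d, ∀ U ∈ O, q' U = q U + d := by
  rcases O.eq_empty_or_nonempty with rfl | ⟨U₀, hU₀⟩
  · exact ⟨0, by simp⟩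
  refine ⟨q' U₀ - q U₀, fun U hU => ?_⟩
  ext k
  have hd : ∀ {r : V → EuclideanSpace ℝ (Fin n)}, ContDiffOn ℝ ∞ r O → ∀ W ∈ O,
      DifferentiableAt ℝ (fun W => r W k) W := fun hr W hW =>
    ((contDiffOn_piLp 2 |>.1 hr k).contDiffAt (hO.mem_nhds hW)).differentiableAt (by simp)
  have := hO.is_const_of_fderiv_eq_zero (𝕜 := ℝ) hO' (f := fun W => q' W k - q W k)
    (fun W hW => ((hd h'.2.1 W hW).sub (hd h.2.1 W hW)).differentiableWithinAt)
    (fun W hW => by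
      rw [fderiv_fun_sub (hd h'.2.1 W hW) (hd h.2.1 W hW), h.2.2 k W hW, h'.2.2 k W hW, sub_self]
      rfl) hU hU₀
  simp only [PiLp.add_apply, PiLp.sub_apply]
  linarith

namespace FullEuler

/-! ### Primitive variables -/

variable {n : ℕ} {γ : ℝ}

/-- The conserved variables of the state with density `ρ`, velocity `u` and pressure `p`. -/
noncomputable def ofPrimitive (γ ρ : ℝ) (u : EuclideanSpace ℝ (Fin n)) (p : ℝ) : State n :=
  (ρ, ρ • u, p / (γ - 1) + ρ * (‖u‖ ^ 2 / 2))

/-- The derivative of `ofPrimitive` at `(ρ, u)` in the direction `(ρ', u', p')`; the map is affine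
in the pressure, so the base pressure does not enter. -/
noncomputable def ofPrimitiveDeriv (γ ρ : ℝ) (u : EuclideanSpace ℝ (Fin n)) (ρ' : ℝ)
    (u' : EuclideanSpace ℝ (Fin n)) (p' : ℝ) : State n :=
  (ρ', ρ' • u + ρ • u', p' / (γ - 1) + (ρ' * (‖u‖ ^ 2 / 2) + ρ * inner ℝ u u'))

lemma hasDerivAt_ofPrimitive {ρ p : ℝ → ℝ} {u : ℝ → EuclideanSpace ℝ (Fin n)} {ρ' p' : ℝ}
    {u' : EuclideanSpace ℝ (Fin n)} {t : ℝ} (hρ : HasDerivAt ρ ρ' t) (hu : HasDerivAt u u' t)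
    (hp : HasDerivAt p p' t) :
    HasDerivAt (fun s => ofPrimitive γ (ρ s) (u s) (p s))
      (ofPrimitiveDeriv γ (ρ t) (u t) ρ' u' p') t := by
  refine hρ.prodMk (((hρ.smul hu).congr_deriv (add_comm _ _)).prodMk
    (((hp.div_const _).add (hρ.mul (hu.norm_sq.div_const 2))).congr_deriv ?_))
  ring

lemma pressure_ofPrimitive (hγ : 1 < γ) {ρ : ℝ} (hρ : 0 < ρ) (u : EuclideanSpace ℝ (Fin n))
    (p : ℝ) : pressure γ (ofPrimitive γ ρ u p) = p := by
  have h1 : γ - 1 ≠ 0 := by linarith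
  simp only [pressure, ofPrimitive, norm_smul, Real.norm_eq_abs, abs_of_pos hρ]
  field_simp
  ring

lemma ofPrimitive_mem (hγ : 1 < γ) {ρ p : ℝ} (hρ : 0 < ρ) (hp : 0 < p)
    (u : EuclideanSpace ℝ (Fin n)) : ofPrimitive γ ρ u p ∈ phaseSpace n γ := by
  refine ⟨hρ, ?_⟩
  rwa [pressure_ofPrimitive hγ hρ]

lemma ofPrimitive_velocity (hγ : 1 < γ) {U : State n} (hU : 0 < U.1) :
    ofPrimitive γ U.1 (U.1⁻¹ • U.2.1) (pressure γ U) = U := by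
  have h1 : γ - 1 ≠ 0 := by linarith
  have h2 := hU.ne'
  refine Prod.ext rfl (Prod.ext ?_ ?_)
  · simp [ofPrimitive, h2]
  · simp only [ofPrimitive, pressure, norm_smul, norm_inv, Real.norm_eq_abs, abs_of_pos hU]
    field_simp
    ring

lemma exists_ofPrimitiveDeriv_eq (hγ : 1 < γ) {ρ : ℝ} (hρ : 0 < ρ)
    (u : EuclideanSpace ℝ (Fin n)) (w : State n) :
    ∃ ρ' u' p', ofPrimitiveDeriv γ ρ u ρ' u' p' = w := by
  have h1 : γ - 1 ≠ 0 := by linarith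
  have h2 := hρ.ne'
  obtain ⟨r, m, e⟩ := w
  refine ⟨r, ρ⁻¹ • (m - r • u), (γ - 1) * (e - (r * (‖u‖ ^ 2 / 2)
    + ρ * inner ℝ u (ρ⁻¹ • (m - r • u)))), ?_⟩
  refine Prod.ext rfl (Prod.ext ?_ ?_)
  · simp [ofPrimitiveDeriv, h2]
  · simp only [ofPrimitiveDeriv]
    field_simp
    ring

lemma contDiffOn_pressure : ContDiffOn ℝ ∞ (pressure γ : State n → ℝ) {U | 0 < U.1} := by
  intro U hU
  have hU' : U.1 ≠ 0 := (show 0 < U.1 from hU).ne'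
  have : ContDiffAt ℝ ∞ (pressure γ : State n → ℝ) U := by
    unfold pressure
    refine contDiffAt_const.mul (ContDiffAt.sub (by fun_prop) (contDiffAt_const.mul
      (ContDiffAt.div (ContDiffAt.norm_sq ℝ (by fun_prop)) (by fun_prop) hU')))
  exact this.contDiffWithinAt

lemma isOpen_pos_density : IsOpen {U : State n | 0 < U.1} :=
  isOpen_lt continuous_const continuous_fst

lemma contDiffAt_pressure {U : State n} (hU : 0 < U.1) :
    ContDiffAt ℝ ∞ (pressure γ : State n → ℝ) U :=
  contDiffOn_pressure.contDiffAt (isOpen_pos_density.mem_nhds hU)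

lemma isOpen_phaseSpace : IsOpen (phaseSpace n γ) :=
  contDiffOn_pressure.continuousOn.isOpen_inter_preimage isOpen_pos_density isOpen_Ioi

lemma contDiffAt_flux (k : Fin n) {U : State n} (hU : 0 < U.1) :
    ContDiffAt ℝ ∞ (flux γ k) U := by
  have hp := contDiffAt_pressure (γ := γ) hU
  have hk : ContDiffAt ℝ ∞ (fun U : State n => U.2.1 k) U := by fun_prop
  have hd : ContDiffAt ℝ ∞ (fun U : State n => U.2.1 k / U.1) U :=
    hk.div (by fun_prop) hU.ne'
  unfold flux
  exact hk.prodMk (((hd.smul (by fun_prop)).add (hp.smul contDiffAt_const)).prodMk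
    (((by fun_prop : ContDiffAt ℝ ∞ (fun U : State n => U.2.2) U).add hp).mul hd))

lemma flux_ofPrimitive (hγ : 1 < γ) (k : Fin n) {ρ : ℝ} (hρ : 0 < ρ)
    (u : EuclideanSpace ℝ (Fin n)) (p : ℝ) :
    flux γ k (ofPrimitive γ ρ u p) = u k • ofPrimitive γ ρ u p
      + p • ((0, EuclideanSpace.single k 1, u k) : State n) := by
  have h2 := hρ.ne'
  rw [flux, pressure_ofPrimitive hγ hρ]
  simp only [ofPrimitive, PiLp.smul_apply, smul_eq_mul, Prod.smul_mk, Prod.mk_add_mk]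
  refine Prod.ext ?_ (Prod.ext ?_ ?_)
  · simp; ring
  · simp [h2]
  · simp only
    field_simp

/-- The flux transports a perturbation of the state with the velocity, up to the terms created by
the compression `u' k` and by the pressure perturbation `p'`. -/
lemma fderiv_flux_ofPrimitive (hγ : 1 < γ) (k : Fin n) {ρ : ℝ} (hρ : 0 < ρ)
    (u : EuclideanSpace ℝ (Fin n)) (p ρ' : ℝ) (u' : EuclideanSpace ℝ (Fin n)) (p' : ℝ) :
    fderiv ℝ (flux γ k) (ofPrimitive γ ρ u p) (ofPrimitiveDeriv γ ρ u ρ' u' p') =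
      u k • ofPrimitiveDeriv γ ρ u ρ' u' p'
        + u' k • (ofPrimitive γ ρ u p + (0, 0, p))
        + p' • ((0, EuclideanSpace.single k 1, u k) : State n) := by
  have hl : ∀ x x' : ℝ, HasDerivAt (fun t : ℝ => x + t * x') x' 0 := fun x x' => by
    simpa using ((hasDerivAt_id (0 : ℝ)).mul_const x').const_add x
  have hv : HasDerivAt (fun t : ℝ => u + t • u') u' 0 := by
    simpa using ((hasDerivAt_id (0 : ℝ)).smul_const u').const_add u
  have hvk : HasDerivAt (fun t : ℝ => (u + t • u') k) (u' k) 0 := by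
    simpa using hl (u k) (u' k)
  have hc := hasDerivAt_ofPrimitive (γ := γ) (hl ρ ρ') hv (hl p p')
  have hF : HasFDerivAt (flux γ k) (fderiv ℝ (flux γ k) (ofPrimitive γ ρ u p))
      (ofPrimitive γ ρ u p) :=
    ((contDiffAt_flux (γ := γ) k (U := ofPrimitive γ ρ u p) hρ).differentiableAt
      (by simp)).hasFDerivAt
  have h1 := HasFDerivAt.comp_hasDerivAt_of_eq (0 : ℝ) hF hc (by simp)
  have hpos : ∀ᶠ t in nhds (0 : ℝ), 0 < ρ + t * ρ' :=
    (hl ρ ρ').continuousAt.eventually (lt_mem_nhds (by simpa using hρ))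
  have hpart : HasDerivAt (fun t : ℝ => ((0, EuclideanSpace.single k 1, (u + t • u') k) : State n))
      (0, 0, u' k) 0 :=
    (hasDerivAt_const _ _).prodMk ((hasDerivAt_const _ _).prodMk hvk)
  have h2 := (hvk.smul hc).add ((hl p p').smul hpart)
  have h3 := h2.congr_of_eventuallyEq (f₁ := flux γ k ∘ fun t => ofPrimitive γ (ρ + t * ρ') (u + t • u')
    (p + t * p')) (hpos.mono fun t ht => flux_ofPrimitive hγ k ht _ _)
  have h4 := h1.unique h3
  simp only [zero_mul, add_zero, zero_smul] at h4
  rw [h4]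
  have h5 : p • ((0, 0, u' k) : State n) = u' k • ((0, 0, p) : State n) := by
    simp [Prod.smul_mk, mul_comm]
  rw [h5, smul_add]
  abel

/-! ### Companion pairs in primitive variables -/

lemma hasDerivAt_comp_ofPrimitive (hγ : 1 < γ) {f : State n → ℝ}
    (hf : ContDiffOn ℝ ∞ f (phaseSpace n γ)) {ρ p : ℝ → ℝ} {u : ℝ → EuclideanSpace ℝ (Fin n)}
    {ρ' p' : ℝ} {u' : EuclideanSpace ℝ (Fin n)} {t : ℝ} (hρ : HasDerivAt ρ ρ' t)
    (hu : HasDerivAt u u' t) (hp : HasDerivAt p p' t) (hρ0 : 0 < ρ t) (hp0 : 0 < p t) :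
    HasDerivAt (fun s => f (ofPrimitive γ (ρ s) (u s) (p s)))
      (fderiv ℝ f (ofPrimitive γ (ρ t) (u t) (p t))
        (ofPrimitiveDeriv γ (ρ t) (u t) ρ' u' p')) t := by
  have h1 := (hf.contDiffAt (isOpen_phaseSpace.mem_nhds
    (ofPrimitive_mem hγ hρ0 hp0 (u t)))).differentiableAt (by simp)
  exact h1.hasFDerivAt.comp_hasDerivAt t (hasDerivAt_ofPrimitive hρ hu hp)

/-- The coefficient `ρ η_ρ + γ p η_p - η` (derivatives in primitive variables) that multiplies
`div u` in the companion law written in convective form. -/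
noncomputable def dilation (γ : ℝ) (η : State n → ℝ) (ρ : ℝ) (u : EuclideanSpace ℝ (Fin n))
    (p : ℝ) : ℝ :=
  fderiv ℝ η (ofPrimitive γ ρ u p) (ofPrimitive γ ρ u p + (0, 0, p)) - η (ofPrimitive γ ρ u p)

/-- The derivative of the relative flux `q_k - u_k η` along a curve: it does not see the
perturbation of the density. -/
lemma hasDerivAt_relativeFlux (hγ : 1 < γ) {η : State n → ℝ}
    {q : State n → EuclideanSpace ℝ (Fin n)}
    (h : IsCompanionPair (phaseSpace n γ) (flux γ) η q) (k : Fin n) {ρ p : ℝ → ℝ}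
    {u : ℝ → EuclideanSpace ℝ (Fin n)}
    {ρ' p' : ℝ} {u' : EuclideanSpace ℝ (Fin n)} {t : ℝ} (hρ : HasDerivAt ρ ρ' t)
    (hu : HasDerivAt u u' t) (hp : HasDerivAt p p' t) (hρ0 : 0 < ρ t) (hp0 : 0 < p t) :
    HasDerivAt (fun s => q (ofPrimitive γ (ρ s) (u s) (p s)) k
        - u s k * η (ofPrimitive γ (ρ s) (u s) (p s)))
      (u' k * dilation γ η (ρ t) (u t) (p t) + p' * fderiv ℝ η (ofPrimitive γ (ρ t) (u t) (p t))
        (0, EuclideanSpace.single k 1, u t k)) t := by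
  obtain ⟨hη, hq, hF⟩ := h
  have hqk : ContDiffOn ℝ ∞ (fun W => q W k) (phaseSpace n γ) := contDiffOn_piLp 2 |>.1 hq k
  have h1 := hasDerivAt_comp_ofPrimitive hγ hqk hρ hu hp hρ0 hp0
  have h2 := hasDerivAt_comp_ofPrimitive hγ hη hρ hu hp hρ0 hp0
  have huk : HasDerivAt (fun s => u s k) (u' k) t := 
    (EuclideanSpace.proj k : EuclideanSpace ℝ (Fin n) →L[ℝ] ℝ).hasFDerivAt.comp_hasDerivAt t hu
  refine (h1.sub (huk.mul h2)).congr_deriv ?_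
  rw [hF k _ (ofPrimitive_mem hγ hρ0 hp0 (u t)), ContinuousLinearMap.comp_apply,
    fderiv_flux_ofPrimitive hγ k hρ0, dilation]
  simp only [map_add, map_smul, smul_eq_mul]
  ring

lemma eq_of_hasDerivAt_zero {f : ℝ → ℝ} (h : ∀ x, 0 < x → HasDerivAt f 0 x) {x y : ℝ}
    (hx : 0 < x) (hy : 0 < y) : f x = f y :=
  isOpen_Ioi.is_const_of_deriv_eq_zero (convex_Ioi (0 : ℝ)).isPreconnected
    (fun z hz => (h z hz).differentiableAt.differentiableWithinAt)
    (fun z hz => (h z hz).deriv) hx hy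

/-- The change of a companion with the velocity, divided by the density, is a quadratic polynomial
whose coefficients `A`, `B` may depend on the pressure only; the dilation coefficient is a primitive
of `A`. This step needs two space dimensions. -/
lemma exists_kinetic_coefficients (hn : 2 ≤ n) (hγ : 1 < γ) {η : State n → ℝ}
    (h : IsCompanion (phaseSpace n γ) (flux γ) η) :
    ∃ (A g : ℝ → ℝ) (B : ℝ → EuclideanSpace ℝ (Fin n)),
      (∀ ρ u p, 0 < ρ → 0 < p → dilation γ η ρ u p = g p) ∧
      (∀ p, 0 < p → HasDerivAt g (A p) p) ∧
      ∀ ρ u p, 0 < ρ → 0 < p → η (ofPrimitive γ ρ u p) =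
        η (ofPrimitive γ ρ 0 p) + ρ * (A p * (‖u‖ ^ 2 / 2) + inner ℝ (B p) u) := by
  obtain ⟨q, hq⟩ := h
  set Q : Fin n → ℝ → EuclideanSpace ℝ (Fin n) → ℝ → ℝ := fun k ρ u p =>
    q (ofPrimitive γ ρ u p) k - u k * η (ofPrimitive γ ρ u p) with hQ
  have hline : ∀ (u v : EuclideanSpace ℝ (Fin n)) (t : ℝ),
      HasDerivAt (fun t : ℝ => u + t • v) v t := fun u v t => by
    simpa using ((hasDerivAt_id t).smul_const v).const_add u
  have hQρ : ∀ k ρ ρ' u p, 0 < ρ → 0 < ρ' → 0 < p → Q k ρ u p = Q k ρ' u p := by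
    intro k ρ ρ' u p hρ hρ' hp
    refine eq_of_hasDerivAt_zero (f := fun ρ => Q k ρ u p) (fun x hx => ?_) hρ hρ'
    simpa using hasDerivAt_relativeFlux hγ hq k (hasDerivAt_id x) (hasDerivAt_const x u)
      (hasDerivAt_const x p) hx hp
  have hQt : ∀ k ρ u v p, 0 < ρ → 0 < p → ∀ t : ℝ, HasDerivAt (fun t : ℝ => Q k ρ (u + t • v) p)
      (v k * dilation γ η ρ (u + t • v) p) t := by
    intro k ρ u v p hρ hp t
    simpa only [zero_mul, add_zero] using hasDerivAt_relativeFlux hγ hq k (hasDerivAt_const t ρ)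
      (hline u v t) (hasDerivAt_const t p) hρ hp
  have hQu : ∀ k ρ ρ' (u u' : EuclideanSpace ℝ (Fin n)) p, 0 < ρ → 0 < ρ' → 0 < p →
      u k = u' k → Q k ρ u p = Q k ρ' u' p := by
    intro k ρ ρ' u u' p hρ hρ' hp hk
    rw [hQρ k ρ ρ' u p hρ hρ' hp]
    have h0 : ∀ t : ℝ, HasDerivAt (fun t : ℝ => Q k ρ' (u + t • (u' - u)) p) 0 t := fun t => by
      simpa [hk] using hQt k ρ' u (u' - u) p hρ' hp t
    have := is_const_of_deriv_eq_zero (fun t => (h0 t).differentiableAt)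
      (fun t => (h0 t).deriv) 0 1
    simpa using this
  have hdil1 : ∀ k ρ ρ' (u u' : EuclideanSpace ℝ (Fin n)) p, 0 < ρ → 0 < ρ' → 0 < p →
      u k = u' k → dilation γ η ρ u p = dilation γ η ρ' u' p := by
    intro k ρ ρ' u u' p hρ hρ' hp hk
    have e1 := hQt k ρ u (EuclideanSpace.single k 1) p hρ hp 0
    have e2 := hQt k ρ' u' (EuclideanSpace.single k 1) p hρ' hp 0
    have e3 : (fun t : ℝ => Q k ρ (u + t • EuclideanSpace.single k 1) p) =
        fun t : ℝ => Q k ρ' (u' + t • EuclideanSpace.single k 1) p := by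
      funext t
      exact hQu k ρ ρ' _ _ p hρ hρ' hp (by simp [hk])
    rw [e3] at e1
    simpa using e1.unique e2
  -- A velocity sharing one component with `u` and another one with `0` links the two.
  have hdil : ∀ ρ u p, 0 < ρ → 0 < p → dilation γ η ρ u p = dilation γ η 1 0 p := by
    intro ρ u p hρ hp
    have h01 : (⟨0, by omega⟩ : Fin n) ≠ ⟨1, by omega⟩ := by simp
    rw [hdil1 ⟨0, by omega⟩ ρ 1 u (EuclideanSpace.single ⟨0, by omega⟩ (u ⟨0, by omega⟩)) p hρ
      one_pos hp (by simp)]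
    exact hdil1 ⟨1, by omega⟩ 1 1 _ 0 p one_pos one_pos hp (by simp)
  set g : ℝ → ℝ := fun p => dilation γ η 1 0 p with hg
  have hQg : ∀ k ρ (u : EuclideanSpace ℝ (Fin n)) p, 0 < ρ → 0 < p →
      Q k ρ u p = g p * u k + Q k 1 0 p := by
    intro k ρ u p hρ hp
    rw [hQρ k ρ 1 u p hρ one_pos hp]
    have h0 : ∀ t : ℝ, HasDerivAt (fun t : ℝ => Q k 1 (0 + t • u) p - t * (u k * g p)) 0 t := by
      intro t
      have := (hQt k 1 0 u p one_pos hp t).sub ((hasDerivAt_id t).mul_const (u k * g p))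
      rw [hdil 1 _ p one_pos hp] at this
      exact this.congr_deriv (by simp [hg])
    have := is_const_of_deriv_eq_zero (fun t => (h0 t).differentiableAt)
      (fun t => (h0 t).deriv) 1 0
    simp only [one_smul, zero_add, one_mul, zero_smul, zero_mul, sub_zero] at this
    linarith
  have hQp : ∀ k ρ (u : EuclideanSpace ℝ (Fin n)) p, 0 < ρ → 0 < p →
      HasDerivAt (fun p => g p * u k + Q k 1 0 p) (fderiv ℝ η (ofPrimitive γ ρ u p)
        (0, EuclideanSpace.single k 1, u k)) p := by
    intro k ρ u p hρ hp
    have := hasDerivAt_relativeFlux hγ hq k (hasDerivAt_const p ρ) (hasDerivAt_const p u)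
      (hasDerivAt_id p) hρ hp
    simp only [PiLp.zero_apply, zero_mul, one_mul, zero_add, id] at this
    refine this.congr_of_eventuallyEq ?_
    filter_upwards [lt_mem_nhds hp] with x hx
    exact (hQg k ρ u x hρ hx).symm
  have hH : ∀ k p, 0 < p → HasDerivAt (fun p => Q k 1 0 p) (deriv (fun p => Q k 1 0 p) p) p := by
    intro k p hp
    have := hQp k 1 0 p one_pos hp
    simp only [PiLp.zero_apply, mul_zero, zero_add] at this
    exact this.differentiableAt.hasDerivAt
  have hgd : ∀ p, 0 < p → HasDerivAt g (deriv g p) p := by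
    intro p hp
    have h1 := (hQp ⟨0, by omega⟩ 1 (EuclideanSpace.single ⟨0, by omega⟩ 1) p one_pos hp).sub
      (hH ⟨0, by omega⟩ p hp)
    have h2 : g = (fun p => g p * (EuclideanSpace.single (⟨0, by omega⟩ : Fin n) (1 : ℝ)) ⟨0, by omega⟩
        + Q ⟨0, by omega⟩ 1 0 p) - fun p => Q ⟨0, by omega⟩ 1 0 p := by
      funext x; simp
    rw [← h2] at h1
    exact h1.differentiableAt.hasDerivAt
  set B : ℝ → EuclideanSpace ℝ (Fin n) := fun p =>
    WithLp.toLp 2 fun k => deriv (fun p => Q k 1 0 p) p with hB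
  have hLk : ∀ k ρ (u : EuclideanSpace ℝ (Fin n)) p, 0 < ρ → 0 < p →
      fderiv ℝ η (ofPrimitive γ ρ u p) (0, EuclideanSpace.single k 1, u k)
        = deriv g p * u k + B p k := fun k ρ u p hρ hp =>
    (hQp k ρ u p hρ hp).unique (((hgd p hp).mul_const _).add (hH k p hp))
  have hL : ∀ ρ (u v : EuclideanSpace ℝ (Fin n)) p, 0 < ρ → 0 < p →
      fderiv ℝ η (ofPrimitive γ ρ u p) (0, v, inner ℝ u v)
        = deriv g p * inner ℝ u v + inner ℝ (B p) v := by
    intro ρ u v p hρ hp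
    have e : ((0, v, inner ℝ u v) : State n) =
        ∑ k, v k • ((0, EuclideanSpace.single k 1, u k) : State n) := by
      refine Prod.ext ?_ (Prod.ext ?_ ?_)
      · simp [Prod.fst_sum]
      · simp only [Prod.snd_sum, Prod.fst_sum, Prod.smul_mk]
        ext j
        simp [Finset.sum_apply, Pi.single_apply]
      · simp [Prod.snd_sum, PiLp.inner_apply]
    rw [e, map_sum]
    simp only [map_smul, hLk _ ρ u p hρ hp, PiLp.inner_apply, Finset.mul_sum,
      ← Finset.sum_add_distrib]
    refine Finset.sum_congr rfl fun k _ => ?_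
    simp
    ring
  refine ⟨deriv g, g, B, hdil, hgd, fun ρ u p hρ hp => ?_⟩
  have h0 : ∀ t : ℝ, HasDerivAt (fun t : ℝ => η (ofPrimitive γ ρ (0 + t • u) p)
      - ρ * (deriv g p * (t ^ 2 * (‖u‖ ^ 2 / 2)) + t * inner ℝ (B p) u)) 0 t := by
    intro t
    have h1 := hasDerivAt_comp_ofPrimitive hγ hq.1 (hasDerivAt_const t ρ) (hline 0 u t)
      (hasDerivAt_const t p) hρ hp
    have e : ofPrimitiveDeriv γ ρ (0 + t • u) 0 u 0 =
        ρ • ((0, u, inner ℝ (0 + t • u) u) : State n) := by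
      simp [ofPrimitiveDeriv, Prod.smul_mk]
    rw [e, map_smul, hL ρ _ u p hρ hp] at h1
    have h2 := ((((hasDerivAt_pow 2 t).mul_const (‖u‖ ^ 2 / 2)).const_mul (deriv g p)).add
      ((hasDerivAt_id t).mul_const (inner ℝ (B p) u))).const_mul ρ
    refine (h1.sub h2).congr_deriv ?_
    simp only [zero_add, real_inner_smul_left, real_inner_self_eq_norm_sq, smul_eq_mul]
    norm_num
    ring
  have := is_const_of_deriv_eq_zero (fun t => (h0 t).differentiableAt)
    (fun t => (h0 t).deriv) 1 0
  simp only [one_smul, zero_add, zero_smul] at this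
  norm_num at this
  linarith

/-! ### Every companion has the stated form -/

lemma fderiv_dilation_direction (η : State n → ℝ) (ρ : ℝ) (u : EuclideanSpace ℝ (Fin n))
    (p : ℝ) : fderiv ℝ η (ofPrimitive γ ρ u p) (ofPrimitive γ ρ u p + (0, 0, p)) =
      η (ofPrimitive γ ρ u p) + dilation γ η ρ u p := by
  rw [dilation]; ring

/-- The kinetic coefficients are constant: the difference `η(ρ, u, p) - η(ρ, 0, p)` is homogeneous
of degree one in `ρ`, and `ρ ∂_ρ + γ p ∂_p` minus the identity annihilates it. -/
lemma exists_constant_kinetic_coefficients (hn : 2 ≤ n) (hγ : 1 < γ) {η : State n → ℝ}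
    (h : IsCompanion (phaseSpace n γ) (flux γ) η) :
    ∃ (a β : ℝ) (b : EuclideanSpace ℝ (Fin n)),
      (∀ ρ u p, 0 < ρ → 0 < p → dilation γ η ρ u p = a * p + β) ∧
      ∀ ρ u p, 0 < ρ → 0 < p → η (ofPrimitive γ ρ u p) =
        η (ofPrimitive γ ρ 0 p) + ρ * (a * (‖u‖ ^ 2 / 2) + inner ℝ b u) := by
  obtain ⟨A, g, B, hdil, hg, hkin⟩ := exists_kinetic_coefficients hn hγ h
  obtain ⟨q, hη, -, -⟩ := h
  have h1 : γ - 1 ≠ 0 := by linarith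
  -- `f` is `(η(ρ, u, p) - η(ρ, 0, p)) / ρ`; comparing the dilation coefficient at `u` and at `0`
  -- shows that its derivative in `p` vanishes.
  set f : EuclideanSpace ℝ (Fin n) → ℝ → ℝ := fun u p => A p * (‖u‖ ^ 2 / 2) + inner ℝ (B p) u
    with hf
  have hfd : ∀ u p, 0 < p → HasDerivAt (f u) 0 p := by
    intro u p hp
    have dρ := (hasDerivAt_comp_ofPrimitive hγ hη (hasDerivAt_id (1 : ℝ))
      (hasDerivAt_const 1 u) (hasDerivAt_const 1 p) one_pos hp).sub
      (hasDerivAt_comp_ofPrimitive hγ hη (hasDerivAt_id (1 : ℝ))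
      (hasDerivAt_const 1 0) (hasDerivAt_const 1 p) one_pos hp)
    have dp := (hasDerivAt_comp_ofPrimitive hγ hη (hasDerivAt_const p (1 : ℝ))
      (hasDerivAt_const p u) (hasDerivAt_id p) one_pos hp).sub
      (hasDerivAt_comp_ofPrimitive hγ hη (hasDerivAt_const p (1 : ℝ))
      (hasDerivAt_const p 0) (hasDerivAt_id p) one_pos hp)
    simp only [id] at dρ dp
    have dρ' : HasDerivAt (fun ρ : ℝ => ρ * f u p) (f u p) 1 := by
      simpa using (hasDerivAt_id (1 : ℝ)).mul_const (f u p)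
    have e1 := dρ.unique (dρ'.congr_of_eventuallyEq (by
      filter_upwards [lt_mem_nhds (one_pos : (0 : ℝ) < 1)] with ρ hρ
      simp only [Pi.sub_apply]
      rw [hkin ρ u p hρ hp]
      ring))
    have e2 := dp.congr_of_eventuallyEq (f₁ := f u) (by
      filter_upwards [lt_mem_nhds hp] with x hx
      simp only [Pi.sub_apply]
      rw [hkin 1 u x one_pos hx]
      ring)
    refine e2.congr_deriv ?_
    have g1 := fderiv_dilation_direction (γ := γ) η 1 u p
    have g2 := fderiv_dilation_direction (γ := γ) η 1 0 p
    have split : ∀ u : EuclideanSpace ℝ (Fin n), ofPrimitive γ 1 u p + (0, 0, p) =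
        ofPrimitiveDeriv γ 1 u 1 0 0 + (γ * p) • ofPrimitiveDeriv γ 1 u 0 0 1 := by
      intro u
      refine Prod.ext ?_ (Prod.ext ?_ ?_)
      · simp [ofPrimitive, ofPrimitiveDeriv]
      · simp [ofPrimitive, ofPrimitiveDeriv]
      · simp [ofPrimitive, ofPrimitiveDeriv]
        field_simp
        ring
    rw [split, map_add, map_smul, smul_eq_mul, hdil _ _ _ one_pos hp] at g1 g2
    rw [hkin 1 u p one_pos hp] at g1
    have h3 : γ * p ≠ 0 := by positivity
    refine (mul_eq_zero.1 ?_).resolve_left h3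
    simp only [hf] at e1
    linear_combination g1 - g2 - e1
  have hfc : ∀ u p, 0 < p → f u p = f u 1 := fun u p hp =>
    eq_of_hasDerivAt_zero (hfd u) hp one_pos
  -- Adding the values of `f` at `v` and `-v` cancels the linear term.
  have hA : ∀ p, 0 < p → A p = A 1 := by
    intro p hp
    have e1 := hfc (EuclideanSpace.single ⟨0, by omega⟩ 1) p hp
    have e2 := hfc (-EuclideanSpace.single ⟨0, by omega⟩ 1) p hp
    simp only [hf, norm_neg, inner_neg_right, PiLp.norm_single, norm_one] at e1 e2
    linarith
  have hgc : ∀ p, 0 < p → g p = A 1 * p + (g 1 - A 1) := by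
    intro p hp
    have := eq_of_hasDerivAt_zero (f := fun p => g p - p * A 1) (fun x hx => by
      refine ((hg x hx).sub ((hasDerivAt_id x).mul_const (A 1))).congr_deriv ?_
      rw [hA x hx]; ring) hp one_pos
    simp only [one_mul] at this
    linarith
  refine ⟨A 1, g 1 - A 1, B 1, fun ρ u p hρ hp => ?_, fun ρ u p hρ hp => ?_⟩
  · rw [hdil ρ u p hρ hp, hgc p hp]
  · rw [hkin ρ u p hρ hp]
    exact congrArg (fun x => η (ofPrimitive γ ρ 0 p) + ρ * x) (hfc u p hp)

lemma companion_ofPrimitive (hγ : 1 < γ) (Z : ℝ → ℝ) (a c : ℝ) (b : EuclideanSpace ℝ (Fin n))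
    {ρ : ℝ} (hρ : 0 < ρ) (u : EuclideanSpace ℝ (Fin n)) (p : ℝ) :
    companion γ Z a b c (ofPrimitive γ ρ u p) = -ρ * Z (Real.log (p / ρ ^ γ))
      + a * (p / (γ - 1) + ρ * (‖u‖ ^ 2 / 2)) + ρ * inner ℝ u b + c := by
  rw [companion, pressure_ofPrimitive hγ hρ]
  simp [ofPrimitive, real_inner_smul_left]

/-- At rest, the companion is determined along the isentropes `p = exp s * ρ ^ γ`, and its value at
`ρ = 1` defines the function `Z` of the specific entropy `s`. -/
lemma exists_eq_companion (hn : 2 ≤ n) (hγ : 1 < γ) {η : State n → ℝ}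
    (h : IsCompanion (phaseSpace n γ) (flux γ) η) :
    ∃ (Z : ℝ → ℝ) (a : ℝ) (b : EuclideanSpace ℝ (Fin n)) (c : ℝ), ContDiff ℝ ∞ Z ∧
      ∀ U ∈ phaseSpace n γ, η U = companion γ Z a b c U := by
  obtain ⟨a, β, b, hdil, hkin⟩ := exists_constant_kinetic_coefficients hn hγ h
  obtain ⟨q, hη, -, -⟩ := h
  have h1 : γ - 1 ≠ 0 := by linarith
  set Z : ℝ → ℝ := fun s =>
    -(η (ofPrimitive γ 1 0 (Real.exp s)) - a * (Real.exp s / (γ - 1)) + β) with hZ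
  refine ⟨Z, a, b, -β, ?_, ?_⟩
  · have hc : ContDiff ℝ ∞ fun s => η (ofPrimitive γ 1 0 (Real.exp s)) := by
      rw [← contDiffOn_univ]
      refine hη.comp (contDiffOn_univ.2 ?_) fun s _ =>
        ofPrimitive_mem hγ one_pos (Real.exp_pos s) 0
      unfold ofPrimitive
      fun_prop
    exact ((hc.sub (by fun_prop)).add contDiff_const).neg
  · rintro U ⟨hU1, hU2⟩
    rw [← ofPrimitive_velocity hγ hU1]
    generalize U.1⁻¹ • U.2.1 = u at *
    generalize pressure γ U = p at *
    generalize U.1 = ρ at *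
    set s := Real.log (p / ρ ^ γ) with hs
    have hes : Real.exp s * ρ ^ γ = p := by
      have := Real.rpow_pos_of_pos hU1 γ
      rw [hs, Real.exp_log (by positivity)]
      field_simp
    have hiso := eq_of_hasDerivAt_zero
      (f := fun r => (η (ofPrimitive γ r 0 (Real.exp s * r ^ γ))
        - a * (Real.exp s * r ^ γ / (γ - 1)) + β) / r) (fun r hr => by
      have hr0 := hr.ne'
      have hrγ := Real.rpow_pos_of_pos hr γ
      have dp := (Real.hasDerivAt_rpow_const (p := γ) (Or.inl hr0)).const_mul (Real.exp s)
      have dη := hasDerivAt_comp_ofPrimitive hγ hη (hasDerivAt_id r)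
        (hasDerivAt_const r 0) dp hr (mul_pos (Real.exp_pos s) hrγ)
      refine (((dη.sub ((dp.div_const (γ - 1)).const_mul a)).add_const β).div
        (hasDerivAt_id r) hr0).congr_deriv ?_
      have hg := fderiv_dilation_direction (γ := γ) η r 0 (Real.exp s * r ^ γ)
      have e : ofPrimitive γ r (0 : EuclideanSpace ℝ (Fin n)) (Real.exp s * r ^ γ)
          + (0, 0, Real.exp s * r ^ γ) =
          r • ofPrimitiveDeriv γ r 0 1 0 (Real.exp s * (γ * r ^ (γ - 1))) := by
        refine Prod.ext ?_ (Prod.ext ?_ ?_)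
        · simp [ofPrimitive, ofPrimitiveDeriv]
        · simp [ofPrimitive, ofPrimitiveDeriv]
        · simp [ofPrimitive, ofPrimitiveDeriv, Real.rpow_sub_one hr0]
          field_simp
          ring
      rw [e, map_smul, smul_eq_mul, hdil _ _ _ hr (mul_pos (Real.exp_pos s) hrγ)] at hg
      simp only [id, Real.rpow_sub_one hr0, Pi.sub_apply] at hg ⊢
      rw [div_eq_zero_iff]
      left
      have hx : r * (a * (Real.exp s * (γ * (r ^ γ / r)) / (γ - 1))) =
          a * (Real.exp s * r ^ γ / (γ - 1)) + a * (Real.exp s * r ^ γ) := by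
        field_simp
        ring
      linear_combination hg - hx) hU1 one_pos
    simp only [hes, Real.one_rpow, mul_one, div_one] at hiso
    rw [div_eq_iff hU1.ne'] at hiso
    rw [hkin _ _ _ hU1 hU2, companion_ofPrimitive hγ Z a (-β) b hU1, ← hs, real_inner_comm]
    simp only [hZ]
    linear_combination hiso

/-! ### The given functions are companions -/

lemma contDiffOn_comp_log_pressure {Z : ℝ → ℝ} (hZ : ContDiff ℝ ∞ Z) :
    ContDiffOn ℝ ∞ (fun U : State n => Z (Real.log (pressure γ U / U.1 ^ γ)))
      (phaseSpace n γ) := by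
  intro U hU
  have h1 : U.1 ^ γ ≠ 0 := (Real.rpow_pos_of_pos hU.1 γ).ne'
  have h2 : ContDiffAt ℝ ∞ (fun U : State n => U.1 ^ γ) U :=
    contDiffAt_fst.rpow_const_of_ne hU.1.ne'
  have h3 := ((contDiffAt_pressure (γ := γ) hU.1).div h2 h1).log (div_ne_zero hU.2.ne' h1)
  exact (hZ.contDiffAt.comp U h3).contDiffWithinAt

lemma contDiffOn_companion {Z : ℝ → ℝ} (hZ : ContDiff ℝ ∞ Z) (a : ℝ)
    (b : EuclideanSpace ℝ (Fin n)) (c : ℝ) :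
    ContDiffOn ℝ ∞ (companion γ Z a b c) (phaseSpace n γ) := by
  have h := contDiffOn_comp_log_pressure (n := n) (γ := γ) hZ
  have h1 : ContDiffOn ℝ ∞ (fun U : State n => inner ℝ U.2.1 b) (phaseSpace n γ) :=
    ContDiff.contDiffOn (ContDiff.inner ℝ (by fun_prop) contDiff_const)
  have h2 : ContDiffOn ℝ ∞ (fun U : State n => -U.1) (phaseSpace n γ) := by fun_prop
  have h3 : ContDiffOn ℝ ∞ (fun U : State n => a * U.2.2) (phaseSpace n γ) := by fun_prop
  exact (((h2.mul h).add h3).add h1).add contDiffOn_const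

lemma contDiffOn_companionFlux {Z : ℝ → ℝ} (hZ : ContDiff ℝ ∞ Z) (a : ℝ)
    (b : EuclideanSpace ℝ (Fin n)) :
    ContDiffOn ℝ ∞ (companionFlux γ Z a b) (phaseSpace n γ) := by
  have h := contDiffOn_comp_log_pressure (n := n) (γ := γ) hZ
  have h1 : ContDiffOn ℝ ∞ (fun U : State n => inner ℝ U.2.1 b) (phaseSpace n γ) :=
    ContDiff.contDiffOn (ContDiff.inner ℝ (by fun_prop) contDiff_const)
  have hm : ContDiffOn ℝ ∞ (fun U : State n => U.2.1) (phaseSpace n γ) := by fun_prop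
  have hE : ContDiffOn ℝ ∞ (fun U : State n => U.2.2) (phaseSpace n γ) := by fun_prop
  have hp : ContDiffOn ℝ ∞ (pressure γ : State n → ℝ) (phaseSpace n γ) :=
    contDiffOn_pressure.mono fun U hU => hU.1
  have hu : ContDiffOn ℝ ∞ (fun U : State n => U.1⁻¹ • U.2.1) (phaseSpace n γ) :=
    (contDiffOn_fst.inv fun U hU => hU.1.ne').smul hm
  exact ((((h.smul hm).neg).add ((contDiffOn_const.mul (hE.add hp)).smul hu)).add
    (h1.smul hu)).add (hp.smul contDiffOn_const)

lemma companionFlux_ofPrimitive (hγ : 1 < γ) (Z : ℝ → ℝ) (a c : ℝ)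
    (b : EuclideanSpace ℝ (Fin n)) (k : Fin n)
    {ρ : ℝ} (hρ : 0 < ρ) (u : EuclideanSpace ℝ (Fin n)) (p : ℝ) :
    companionFlux γ Z a b (ofPrimitive γ ρ u p) k =
      u k * (companion γ Z a b c (ofPrimitive γ ρ u p) + a * p - c) + p * b k := by
  rw [companion_ofPrimitive hγ _ _ _ _ hρ, companionFlux, pressure_ofPrimitive hγ hρ]
  simp [ofPrimitive, real_inner_smul_left, hρ.ne']
  ring

/-- Scaling `ρ` by `exp t` and `p` by `exp (γ t)` keeps the specific entropy, so no derivative of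
`Z` appears. -/
lemma dilation_companion (hγ : 1 < γ) {Z : ℝ → ℝ} (hZ : ContDiff ℝ ∞ Z) (a : ℝ)
    (b : EuclideanSpace ℝ (Fin n)) (c : ℝ) {ρ p : ℝ} (hρ : 0 < ρ) (hp : 0 < p)
    (u : EuclideanSpace ℝ (Fin n)) :
    fderiv ℝ (companion γ Z a b c) (ofPrimitive γ ρ u p) (ofPrimitive γ ρ u p + (0, 0, p)) =
      companion γ Z a b c (ofPrimitive γ ρ u p) + a * p - c := by
  have h1 : γ - 1 ≠ 0 := by linarith
  have dρ : HasDerivAt (fun t : ℝ => ρ * Real.exp t) ρ 0 := by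
    simpa using (Real.hasDerivAt_exp 0).const_mul ρ
  have dp : HasDerivAt (fun t : ℝ => p * Real.exp (γ * t)) (γ * p) 0 := by
    simpa [mul_comm] using (((hasDerivAt_id (0 : ℝ)).const_mul γ).exp).const_mul p
  have d1 := hasDerivAt_comp_ofPrimitive hγ (contDiffOn_companion (γ := γ) hZ a b c) dρ
    (hasDerivAt_const 0 u) dp (by simpa using hρ) (by simpa using hp)
  have e : ofPrimitiveDeriv γ ρ u ρ 0 (γ * p) = ofPrimitive γ ρ u p + (0, 0, p) := by
    refine Prod.ext ?_ (Prod.ext ?_ ?_)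
    · simp [ofPrimitive, ofPrimitiveDeriv]
    · simp [ofPrimitive, ofPrimitiveDeriv]
    · simp [ofPrimitive, ofPrimitiveDeriv]
      field_simp
      ring
  simp only [Real.exp_zero, mul_one, mul_zero] at d1
  rw [e] at d1
  have d2 := ((dρ.neg.mul_const (Z (Real.log (p / ρ ^ γ)))).add
    (((dp.div_const (γ - 1)).add (dρ.mul_const (‖u‖ ^ 2 / 2))).const_mul a)).add
    (dρ.mul_const (inner ℝ u b)) |>.add_const c
  refine (d1.unique (d2.congr_of_eventuallyEq (Filter.Eventually.of_forall fun t => ?_))).trans ?_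
  rotate_left
  · rw [companion_ofPrimitive hγ Z a c b hρ]
    field_simp
    ring
  · have hr : p * Real.exp (γ * t) / (ρ * Real.exp t) ^ γ = p / ρ ^ γ := by
      rw [Real.mul_rpow hρ.le (Real.exp_pos t).le, ← Real.exp_mul, mul_comm t γ]
      field_simp
    beta_reduce
    rw [companion_ofPrimitive hγ Z a c b (by positivity), hr]
    rfl

lemma fderiv_companion_velocity (hγ : 1 < γ) {Z : ℝ → ℝ} (hZ : ContDiff ℝ ∞ Z) (a : ℝ)
    (b : EuclideanSpace ℝ (Fin n)) (c : ℝ) {ρ p : ℝ} (hρ : 0 < ρ) (hp : 0 < p)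
    (u v : EuclideanSpace ℝ (Fin n)) :
    fderiv ℝ (companion γ Z a b c) (ofPrimitive γ ρ u p) (0, v, inner ℝ u v) =
      a * inner ℝ u v + inner ℝ v b := by
  have du : HasDerivAt (fun t : ℝ => u + t • v) v 0 := by
    simpa using ((hasDerivAt_id (0 : ℝ)).smul_const v).const_add u
  have d1 := hasDerivAt_comp_ofPrimitive hγ (contDiffOn_companion (γ := γ) hZ a b c)
    (hasDerivAt_const 0 ρ) du (hasDerivAt_const 0 p) hρ hp
  have e : ofPrimitiveDeriv γ ρ u 0 v 0 = ρ • ((0, v, inner ℝ u v) : State n) := by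
    simp [ofPrimitiveDeriv, Prod.smul_mk]
  simp only [zero_smul, add_zero] at d1
  rw [e, map_smul, smul_eq_mul] at d1
  simp only [companion_ofPrimitive hγ Z a c b hρ] at d1
  have d2 := ((((((du.norm_sq.div_const 2).const_mul ρ).const_add (p / (γ - 1))).const_mul a).const_add
    (-ρ * Z (Real.log (p / ρ ^ γ)))).add
    ((du.inner ℝ (hasDerivAt_const 0 b)).const_mul ρ)).add_const c
  have d3 := d1.unique d2
  simp only [zero_smul, add_zero, inner_zero_right, zero_add] at d3
  refine mul_left_cancel₀ hρ.ne' (d3.trans ?_)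
  ring

lemma isCompanionPair_companion (hγ : 1 < γ) {Z : ℝ → ℝ} (hZ : ContDiff ℝ ∞ Z) (a : ℝ)
    (b : EuclideanSpace ℝ (Fin n)) (c : ℝ) :
    IsCompanionPair (phaseSpace n γ) (flux γ) (companion γ Z a b c) (companionFlux γ Z a b) := by
  have hη := contDiffOn_companion (n := n) (γ := γ) hZ a b c
  have hq := contDiffOn_companionFlux (n := n) (γ := γ) hZ a b
  refine ⟨hη, hq, fun k U hU => ?_⟩
  obtain ⟨hU1, hU2⟩ := hU
  rw [← ofPrimitive_velocity hγ hU1]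
  generalize U.1⁻¹ • U.2.1 = u at *
  generalize pressure γ U = p at *
  generalize U.1 = ρ at *
  refine ContinuousLinearMap.ext fun w => ?_
  obtain ⟨ρ', u', p', rfl⟩ := exists_ofPrimitiveDeriv_eq hγ hU1 u w
  have hl : ∀ x x' : ℝ, HasDerivAt (fun t : ℝ => x + t * x') x' 0 := fun x x' => by
    simpa using ((hasDerivAt_id (0 : ℝ)).mul_const x').const_add x
  have du : HasDerivAt (fun t : ℝ => u + t • u') u' 0 := by
    simpa using ((hasDerivAt_id (0 : ℝ)).smul_const u').const_add u
  have duk : HasDerivAt (fun t : ℝ => (u + t • u') k) (u' k) 0 := by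
    simpa using hl (u k) (u' k)
  have hρ0 : 0 < ρ + 0 * ρ' := by simpa using hU1
  have hp0 : 0 < p + 0 * p' := by simpa using hU2
  have d1 := hasDerivAt_comp_ofPrimitive hγ (contDiffOn_piLp 2 |>.1 hq k) (hl ρ ρ') du (hl p p')
    hρ0 hp0
  have d2 := hasDerivAt_comp_ofPrimitive hγ hη (hl ρ ρ') du (hl p p') hρ0 hp0
  have d3 := (duk.mul ((d2.add ((hl p p').const_mul a)).sub_const c)).add
    ((hl p p').mul_const (b k))
  have hpos : ∀ᶠ t in nhds (0 : ℝ), 0 < ρ + t * ρ' :=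
    (hl ρ ρ').continuousAt.eventually (lt_mem_nhds hρ0)
  have d4 := d1.unique (d3.congr_of_eventuallyEq (hpos.mono fun t ht =>
    companionFlux_ofPrimitive hγ Z a c b k ht _ _))
  have hk : ∀ x : EuclideanSpace ℝ (Fin n), inner ℝ x (EuclideanSpace.single k (1 : ℝ)) = x k := by
    intro x; simp [EuclideanSpace.inner_single_right]
  have hv := fderiv_companion_velocity hγ hZ a b c hU1 hU2 u (EuclideanSpace.single k 1)
  rw [real_inner_comm b, hk, hk] at hv
  rw [ContinuousLinearMap.comp_apply, fderiv_flux_ofPrimitive hγ k hU1]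
  simp only [map_add, map_smul, smul_eq_mul]
  rw [← map_add, dilation_companion hγ hZ a b c hU1 hU2, hv]
  simp only [zero_mul, add_zero, zero_smul, Pi.add_apply] at d4
  rw [d4]
  ring

/-! ### Convexity -/

lemma add_smul_pressure_le (hγ : 1 < γ) {U V : State n} (hU : 0 < U.1) (hV : 0 < V.1)
    {s t : ℝ} (hs : 0 ≤ s) (ht : 0 ≤ t) (hr : 0 < s * U.1 + t * V.1) :
    s * pressure γ U + t * pressure γ V ≤ pressure γ (s • U + t • V) := by
  obtain ⟨ρ₁, m₁, E₁⟩ := U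
  obtain ⟨ρ₂, m₂, E₂⟩ := V
  simp only at hU hV hr
  have hkin : ‖s • m₁ + t • m₂‖ ^ 2 / (s * ρ₁ + t * ρ₂)
      ≤ s * (‖m₁‖ ^ 2 / ρ₁) + t * (‖m₂‖ ^ 2 / ρ₂) := by
    have h1 : ‖s • m₁ + t • m₂‖ ≤ s * ‖m₁‖ + t * ‖m₂‖ := by
      refine (norm_add_le _ _).trans (le_of_eq ?_)
      rw [norm_smul, norm_smul, Real.norm_of_nonneg hs, Real.norm_of_nonneg ht]
    have h2 := pow_le_pow_left₀ (norm_nonneg _) h1 2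
    rw [div_le_iff₀ hr]
    refine h2.trans ?_
    have h3 : (s * (‖m₁‖ ^ 2 / ρ₁) + t * (‖m₂‖ ^ 2 / ρ₂)) * (s * ρ₁ + t * ρ₂)
        - (s * ‖m₁‖ + t * ‖m₂‖) ^ 2
        = s * t * (ρ₁ * ‖m₂‖ - ρ₂ * ‖m₁‖) ^ 2 / (ρ₁ * ρ₂) := by
      field_simp
      ring
    have h4 : 0 ≤ s * t * (ρ₁ * ‖m₂‖ - ρ₂ * ‖m₁‖) ^ 2 / (ρ₁ * ρ₂) := by positivity
    linarith
  simp only [pressure, Prod.smul_mk, Prod.mk_add_mk, smul_eq_mul]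
  have h5 : 0 ≤ γ - 1 := by linarith
  have := mul_le_mul_of_nonneg_left hkin h5
  linarith

lemma convex_phaseSpace (hγ : 1 < γ) : Convex ℝ (phaseSpace n γ) := by
  intro U hU V hV s t hs ht hst
  have hr : 0 < s * U.1 + t * V.1 := convex_Ioi (0 : ℝ) hU.1 hV.1 hs ht hst
  have hp : 0 < s * pressure γ U + t * pressure γ V := convex_Ioi (0 : ℝ) hU.2 hV.2 hs ht hst
  exact ⟨hr, hp.trans_le (add_smul_pressure_le hγ hU.1 hV.1 hs ht hr)⟩

lemma log_pressure_div {ρ p : ℝ} (hρ : 0 < ρ) (hp : 0 < p) :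
    Real.log (p / ρ ^ γ) = Real.log (p / ρ) - (γ - 1) * Real.log ρ := by
  rw [Real.log_div hp.ne' (Real.rpow_pos_of_pos hρ γ).ne', Real.log_div hp.ne' hρ.ne',
    Real.log_rpow hρ]
  ring

/-- Concavity of `U ↦ ρ log (p / ρ ^ γ)`, written for the mass fractions `x = s ρ₁ / ρ` and
`y = t ρ₂ / ρ` of the two states in the mixture of density `ρ`. -/
lemma add_log_pressure_le (hγ : 1 < γ) {U V : State n} (hU : U ∈ phaseSpace n γ)
    (hV : V ∈ phaseSpace n γ) {s t x y : ℝ} (hs : 0 ≤ s) (ht : 0 ≤ t) (hst : s + t = 1)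
    (hx : x * (s * U.1 + t * V.1) = s * U.1) (hy : y * (s * U.1 + t * V.1) = t * V.1) :
    x * Real.log (pressure γ U / U.1 ^ γ) + y * Real.log (pressure γ V / V.1 ^ γ) ≤
      Real.log (pressure γ (s • U + t • V) / (s * U.1 + t * V.1) ^ γ) := by
  have hr : 0 < s * U.1 + t * V.1 := convex_Ioi (0 : ℝ) hU.1 hV.1 hs ht hst
  have hW := (convex_phaseSpace hγ hU hV hs ht hst).2
  have hp := add_smul_pressure_le hγ hU.1 hV.1 hs ht hr
  obtain ⟨hU1, hU2⟩ := hU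
  obtain ⟨hV1, hV2⟩ := hV
  rw [log_pressure_div hU1 hU2, log_pressure_div hV1 hV2, log_pressure_div hr hW]
  have hx0 : 0 ≤ x := by
    rw [← eq_div_iff hr.ne'] at hx
    rw [hx]; positivity
  have hy0 : 0 ≤ y := by
    rw [← eq_div_iff hr.ne'] at hy
    rw [hy]; positivity
  have hxy : x + y = 1 := by
    refine mul_right_cancel₀ hr.ne' ?_
    linear_combination hx + hy
  have hT1 := strictConcaveOn_log_Ioi.concaveOn.2 (div_pos hU2 hU1) (div_pos hV2 hV1) hx0 hy0 hxy
  have hTpos : 0 < x * (pressure γ U / U.1) + y * (pressure γ V / V.1) :=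
    convex_Ioi (0 : ℝ) (div_pos hU2 hU1) (div_pos hV2 hV1) hx0 hy0 hxy
  have hT2 : x * (pressure γ U / U.1) + y * (pressure γ V / V.1) ≤
      pressure γ (s • U + t • V) / (s * U.1 + t * V.1) := by
    rw [le_div_iff₀ hr]
    refine (le_of_eq ?_).trans hp
    have e1 : x * (pressure γ U / U.1) * (s * U.1 + t * V.1) = s * pressure γ U := by
      rw [mul_right_comm, hx]; field_simp
    have e2 : y * (pressure γ V / V.1) * (s * U.1 + t * V.1) = t * pressure γ V := by
      rw [mul_right_comm, hy]; field_simp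
    rw [add_mul, e1, e2]
  have hT3 := Real.log_le_log hTpos hT2
  have hR := Real.convexOn_mul_log.2 (Set.mem_Ici.2 hU1.le) (Set.mem_Ici.2 hV1.le) hs ht hst
  simp only [smul_eq_mul] at hT1 hR
  have hR' : Real.log (s * U.1 + t * V.1) ≤ x * Real.log U.1 + y * Real.log V.1 := by
    refine le_of_mul_le_mul_left (hR.trans (le_of_eq ?_)) hr
    linear_combination -Real.log U.1 * hx - Real.log V.1 * hy
  have hR2 := mul_le_mul_of_nonneg_left hR' (by linarith : (0 : ℝ) ≤ γ - 1)
  linarith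

lemma convexOn_companion (hγ : 1 < γ) {Z : ℝ → ℝ} (hmono : Monotone Z)
    (hconc : ConcaveOn ℝ Set.univ Z) (a : ℝ) (b : EuclideanSpace ℝ (Fin n)) (c : ℝ) :
    ConvexOn ℝ (phaseSpace n γ) (companion γ Z a b c) := by
  refine ⟨convex_phaseSpace hγ, fun U hU V hV s t hs ht hst => ?_⟩
  have hr : 0 < s * U.1 + t * V.1 := convex_Ioi (0 : ℝ) hU.1 hV.1 hs ht hst
  have hx : s * U.1 / (s * U.1 + t * V.1) * (s * U.1 + t * V.1) = s * U.1 := by field_simp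
  have hy : t * V.1 / (s * U.1 + t * V.1) * (s * U.1 + t * V.1) = t * V.1 := by field_simp
  have hx0 : 0 ≤ s * U.1 / (s * U.1 + t * V.1) := div_nonneg (mul_nonneg hs hU.1.le) hr.le
  have hy0 : 0 ≤ t * V.1 / (s * U.1 + t * V.1) := div_nonneg (mul_nonneg ht hV.1.le) hr.le
  have hS := hmono (add_log_pressure_le hγ hU hV hs ht hst hx hy)
  generalize s * U.1 / (s * U.1 + t * V.1) = x at *
  generalize t * V.1 / (s * U.1 + t * V.1) = y at *
  have hxy : x + y = 1 := by
    refine mul_right_cancel₀ hr.ne' ?_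
    linear_combination hx + hy
  have hZ := hconc.2 (Set.mem_univ (Real.log (pressure γ U / U.1 ^ γ)))
    (Set.mem_univ (Real.log (pressure γ V / V.1 ^ γ))) hx0 hy0 hxy
  simp only [smul_eq_mul] at hZ
  have hfin := mul_le_mul_of_nonneg_left (hZ.trans hS) hr.le
  simp only [companion, Prod.fst_add, Prod.snd_add, Prod.smul_fst, Prod.smul_snd, smul_eq_mul,
    inner_add_left, real_inner_smul_left]
  generalize Z (Real.log (pressure γ U / U.1 ^ γ)) = z₁ at *
  generalize Z (Real.log (pressure γ V / V.1 ^ γ)) = z₂ at *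
  have e : (s * U.1 + t * V.1) * (x * z₁ + y * z₂) = s * U.1 * z₁ + t * V.1 * z₂ := by
    linear_combination z₁ * hx + z₂ * hy
  have ec : c = s * c + t * c := by rw [← add_mul, hst, one_mul]
  linarith

/-- Two states of opposite velocities with density `1` and pressure `exp x` have as midpoint a
state at rest of pressure `exp y`, `x ≤ y`, when the kinetic energy is chosen accordingly. -/
lemma monotone_of_convexOn_companion (hn : 1 ≤ n) (hγ : 1 < γ) {Z : ℝ → ℝ} {a : ℝ}
    {b : EuclideanSpace ℝ (Fin n)} {c : ℝ}
    (h : ConvexOn ℝ (phaseSpace n γ) (companion γ Z a b c)) : Monotone Z := by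
  intro x y hxy
  have h1 : 0 < γ - 1 := by linarith
  have hexp : 0 ≤ Real.exp y - Real.exp x := sub_nonneg.2 (Real.exp_le_exp.2 hxy)
  set τ := Real.sqrt (2 * (Real.exp y - Real.exp x) / (γ - 1)) with hτ
  have hτ2 : τ ^ 2 = 2 * (Real.exp y - Real.exp x) / (γ - 1) := Real.sq_sqrt (by positivity)
  set v : EuclideanSpace ℝ (Fin n) := EuclideanSpace.single ⟨0, by omega⟩ τ with hv
  have hnorm : ‖v‖ ^ 2 = τ ^ 2 := by simp [hv]
  have hE : Real.exp x / (γ - 1) + 1 * (‖v‖ ^ 2 / 2) = Real.exp y / (γ - 1) := by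
    rw [hnorm, hτ2]
    field_simp
    ring
  have hmid : (1 / 2 : ℝ) • ofPrimitive γ 1 v (Real.exp x)
      + (1 / 2 : ℝ) • ofPrimitive γ 1 (-v) (Real.exp x) = ofPrimitive γ 1 0 (Real.exp y) := by
    simp only [ofPrimitive, norm_neg, hE]
    refine Prod.ext ?_ (Prod.ext ?_ ?_)
    · norm_num
    · simp
    · simp; ring
  have hc := h.2 (ofPrimitive_mem hγ one_pos (Real.exp_pos x) v)
    (ofPrimitive_mem hγ one_pos (Real.exp_pos x) (-v)) (by norm_num : (0 : ℝ) ≤ 1 / 2)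
    (by norm_num : (0 : ℝ) ≤ 1 / 2) (by norm_num)
  rw [hmid] at hc
  simp only [companion_ofPrimitive hγ Z a c b one_pos, norm_neg, hE, inner_neg_left,
    inner_zero_left, norm_zero, Real.one_rpow, div_one, Real.log_exp, smul_eq_mul] at hc
  norm_num at hc
  linarith

end FullEuler

theorem mainTheorem11 (n : ℕ) (hn : 2 ≤ n) (γ : ℝ) (hγ : 1 < γ) :
    (∀ η : FullEuler.State n → ℝ,
      IsCompanion (FullEuler.phaseSpace n γ) (FullEuler.flux γ) η ↔
        ∃ (Z : ℝ → ℝ) (a : ℝ) (b : EuclideanSpace ℝ (Fin n)) (c : ℝ), ContDiff ℝ ∞ Z ∧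
          ∀ U ∈ FullEuler.phaseSpace n γ, η U = FullEuler.companion γ Z a b c U) ∧
    (∀ (Z : ℝ → ℝ) (a : ℝ) (b : EuclideanSpace ℝ (Fin n)) (c : ℝ), ContDiff ℝ ∞ Z →
      ∀ q : FullEuler.State n → EuclideanSpace ℝ (Fin n),
        IsCompanionPair (FullEuler.phaseSpace n γ) (FullEuler.flux γ)
            (FullEuler.companion γ Z a b c) q ↔
          ∃ d : EuclideanSpace ℝ (Fin n), ∀ U ∈ FullEuler.phaseSpace n γ,
            q U = FullEuler.companionFlux γ Z a b U + d) ∧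
    (∀ (Z : ℝ → ℝ) (a : ℝ) (b : EuclideanSpace ℝ (Fin n)) (c : ℝ), ContDiff ℝ ∞ Z →
      (∀ s : ℝ, 0 ≤ deriv Z s) → (∀ s : ℝ, deriv (deriv Z) s ≤ 0) →
        IsEntropy (FullEuler.phaseSpace n γ) (FullEuler.flux γ)
          (FullEuler.companion γ Z a b c)) ∧
    (∀ (Z : ℝ → ℝ) (a : ℝ) (b : EuclideanSpace ℝ (Fin n)) (c : ℝ), ContDiff ℝ ∞ Z →
      IsEntropy (FullEuler.phaseSpace n γ) (FullEuler.flux γ)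
          (FullEuler.companion γ Z a b c) →
        ∀ s : ℝ, 0 ≤ deriv Z s) := by
  refine ⟨fun η => ⟨FullEuler.exists_eq_companion hn hγ, ?_⟩, fun Z a b c hZ q => ⟨fun h => ?_, ?_⟩,
    fun Z a b c hZ h1 h2 => ⟨⟨_, FullEuler.isCompanionPair_companion hγ hZ a b c⟩, ?_⟩,
    fun Z a b c hZ h s => ?_⟩
  · rintro ⟨Z, a, b, c, hZ, h⟩
    exact ⟨FullEuler.companionFlux γ Z a b,
      (FullEuler.isCompanionPair_companion hγ hZ a b c).congr_add_const
        FullEuler.isOpen_phaseSpace 0 h (by simp)⟩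
  · exact (FullEuler.isCompanionPair_companion hγ hZ a b c).exists_eq_add_const
      FullEuler.isOpen_phaseSpace (FullEuler.convex_phaseSpace hγ).isPreconnected h
  · rintro ⟨d, hd⟩
    exact (FullEuler.isCompanionPair_companion hγ hZ a b c).congr_add_const
      FullEuler.isOpen_phaseSpace d (fun _ _ => rfl) hd
  · have hZd : Differentiable ℝ Z := hZ.differentiable (by simp)
    have hZd' : Differentiable ℝ (deriv Z) :=
      ((contDiff_infty_iff_deriv.1 hZ).2).differentiable (by simp)
    exact FullEuler.convexOn_companion hγ (monotone_of_deriv_nonneg hZd h1)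
      (concaveOn_univ_of_deriv2_nonpos hZd hZd' h2) a b c
  · exact (FullEuler.monotone_of_convexOn_companion (by omega) hγ h.2).deriv_nonneg
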